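/- **Proposition (Shannon entropy).** Let $\gamma,\theta,a,b,c>0$. Let $G(x)=e^{-\gamma x^{-\theta}}$ and $g(x)=\theta\gamma x^{-\theta-1}e^{-\gamma x^{-\theta}}$ ($x>0$) be the distribution function and density of the inverse Weibull distribution, and let $X$ be a real random variable with the reflected generalized beta (of the first type) inverse Weibull distribution (rGB1-IWei), i.e. with density $$f(x)=\frac{c}{B(a,b)}\,[1-G(x)]^{ac-1}\bigl(1-[1-G(x)]^{c}\bigr)^{b-1}g(x)\quad(x>0),\qquad f(x)=0\quad(x\le 0),$$ where $B$ is the Beta function. For $s>0$ and $j\in\{0,1,2,\dots\}$ put $$p_{j,s}=\frac{(-1)^{j}\,\Gamma(s)}{\Gamma(s-j)\,\Gamma(j+1)},$$ with $1/\Gamma$ read as $0$ at the poles of $\Gamma$, and let $\psi=\Gamma'/\Gamma$ be the digamma function. Then $\log f(X)$ is integrable, and the Shannon entropy $H(f)=-E[\log f(X)]$ of $X$ is $$ \begin{aligned} H(f)={}&-\log\left(\frac{c\,\theta\,\gamma}{B(a,b)}\right)+\frac{c}{B(a,b)}\sum_{j_1=0}^{\infty}\sum_{j_2=0}^{\infty}p_{j_1,b}\,p_{j_2,c(a+j_1)}\Biggl\{\frac{\theta+1}{\theta}\cdot\frac{\log[(j_2+1)\gamma]-\Gamma'(1)}{j_2+1}\\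 &-\frac{ac-1}{j_2+1}\bigl[\psi(1)-\psi(j_2+2)\bigr]+\frac{1}{(j_2+1)^2}-(b-1)\sum_{i=0}^{\infty}\frac{p_{i,j_2+1}}{i+1}\Bigl[\psi(1)-\psi\Bigl(\frac{i+1}{c}+1\Bigr)\Bigr]\Biggr\}. \end{aligned} $$ The double series is an iterated series (first over $j_2$, then over $j_1$). For every $j_2$ the series over $i$, for every $j_1$ the series over $j_2$, and the resulting series over $j_1$ converge absolutely. -/

import Mathlib

open MeasureTheory ProbabilityTheory

noncomputable section

namespace RGB1IWei

/-- The cumulative distribution function `G(x) = exp (-γ x ^ (-θ))`, `x > 0`, of the inverse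
Weibull distribution with parameters `γ, θ > 0` (it vanishes for `x ≤ 0`). -/
def iweiCDF (γ θ x : ℝ) : ℝ :=
  if 0 < x then Real.exp (-γ * x ^ (-θ)) else 0

/-- The inverse Weibull density `g(x) = θ γ x ^ (-θ - 1) exp (-γ x ^ (-θ))`, `x > 0`. -/
def iweiPDF (γ θ x : ℝ) : ℝ :=
  if 0 < x then θ * γ * x ^ (-θ - 1) * Real.exp (-γ * x ^ (-θ)) else 0

/-- The density of the reflected generalized beta (of the first type) inverse Weibull
distribution,
`f(x) = c / B(a,b) * (1 - G(x)) ^ (a c - 1) * (1 - (1 - G(x)) ^ c) ^ (b - 1) * g(x)`,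
where `G` and `g` are the inverse Weibull distribution function and density. It vanishes for
`x ≤ 0`. -/
def density (γ θ a b c x : ℝ) : ℝ :=
  c / beta a b * (1 - iweiCDF γ θ x) ^ (a * c - 1)
    * (1 - (1 - iweiCDF γ θ x) ^ c) ^ (b - 1) * iweiPDF γ θ x

/-- The `rGB1-IWei` distribution with parameters `γ, θ, a, b, c`, as a measure on `ℝ`. -/
def law (γ θ a b c : ℝ) : Measure ℝ :=
  volume.withDensity fun x => ENNReal.ofReal (density γ θ a b c x)

/-- The Shannon (differential) entropy `-E[log f_X(X)]` of a real random variable `X` that has a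
density `f_X` with respect to Lebesgue measure. -/
def shannonEntropy {Ω : Type*} [MeasurableSpace Ω] (X : Ω → ℝ) (P : Measure Ω) : ℝ :=
  -∫ ω, Real.log (pdf X P volume (X ω)).toReal ∂P

/-- The digamma function `ψ = Γ' / Γ` on the reals. -/
def digamma (x : ℝ) : ℝ := deriv Real.Gamma x / Real.Gamma x

/-- The coefficient `p_{j,s} = (-1)^j Γ(s) / (Γ(s - j) Γ(j + 1))`, that is
`(-1)^j (s - 1 choose j)`. If `s` is a positive integer and `j ≥ s`, then `1 / Γ(s - j)` stands for
`0`; this is what the expression below gives, as `Real.Gamma` is `0` at the poles and `x / 0 = 0`. -/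
def coeff (j : ℕ) (s : ℝ) : ℝ :=
  (-1) ^ j * Real.Gamma s / (Real.Gamma (s - j) * Real.Gamma (j + 1))

/-- The `i`-th term of the innermost series. -/
def innerTerm (c : ℝ) (j₂ i : ℕ) : ℝ :=
  coeff i (j₂ + 1) / (i + 1) * (digamma 1 - digamma ((i + 1) / c + 1))

/-- The term with indices `j₁`, `j₂` of the double series. -/
def doubleTerm (γ θ a b c : ℝ) (j₁ j₂ : ℕ) : ℝ :=
  coeff j₁ b * coeff j₂ (c * (a + j₁)) *
    ((θ + 1) / θ * ((Real.log ((j₂ + 1) * γ) - deriv Real.Gamma 1) / (j₂ + 1))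
      - (a * c - 1) / (j₂ + 1) * (digamma 1 - digamma (j₂ + 2))
      + 1 / ((j₂ : ℝ) + 1) ^ 2
      - (b - 1) * ∑' i : ℕ, innerTerm c j₂ i)

end RGB1IWei

end

open Set Filter Topology

namespace RGB1IWei


/-! ### The binomial coefficients `coeff j s` -/

/-! The substitution `u = G(x)` reduces the entropy to an integral over `(0, 1)`. Since `log (-log
G(x)) = log γ - θ log x`, the logarithm of the density is a constant minus `logTerm`, a combination
of `log (-log u)`, `log (1 - u)`, `log u` and `log (1 - (1 - u) ^ c)`. It remains to integrate
`logTerm` against `unitWeight`.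

The series come from expanding `(1 - w) ^ (s - 1) = ∑ coeff j s * w ^ j` three times: with `w = (1 -
u) ^ c`, `s = b`; with `w = u`, `s = c (a + j₁)`; and, inside the last logarithm, with `w = 1 - u`,
`s = j₂ + 1`. What is left are the moments of the four logarithms, given by the derivative of the
beta function and by `Γ'(1)`.

The analytic point is the exchange of sum and integral, `hasSum_integral_coeff`. The coefficients
eventually have constant sign, so `∑ |coeff j s| w ^ j` is a multiple of `(1 - w) ^ (s - 1)` plus a
polynomial. Hence dominated convergence needs only that `F` and `(1 - w) ^ (s - 1) * F` be
integrable, even when `s < 1`. Integrability holds at each stage because all singularities of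
`logTerm` are logarithmic (`logBound`) and the weights are of beta type. Absolute convergence is
part of `HasSum` over `ℝ`. -/

lemma coeff_zero {s : ℝ} (hs : 0 < s) : coeff 0 s = 1 := by
  have := (Real.Gamma_pos_of_pos hs).ne'
  simp [coeff, this]

lemma coeff_succ (j : ℕ) (s : ℝ) : coeff (j + 1) s = coeff j s * ((j + 1 - s) / (j + 1)) := by
  have hj : ((j : ℝ) + 1) ≠ 0 := by positivity
  have hj2 : Real.Gamma ((j : ℝ) + 1) ≠ 0 := (Real.Gamma_pos_of_pos (by positivity)).ne'
  unfold coeff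
  push_cast
  rw [Real.Gamma_add_one hj]
  by_cases h : s - (j + 1) = 0
  · have h2 : (j : ℝ) + 1 - s = 0 := by linarith
    simp [h, h2]
  · have h1 : Real.Gamma (s - j) = (s - (j + 1)) * Real.Gamma (s - (j + 1)) := by
      rw [← Real.Gamma_add_one h]; congr 1; ring
    rw [h1]
    -- At a pole `Γ(s - j)` is also `0` by `h1`, so both sides vanish under division by zero.
    by_cases h3 : Real.Gamma (s - (j + 1)) = 0
    · simp [h3]
    · field_simp
      ring

lemma coeff_eq_choose {s : ℝ} (hs : 0 < s) (j : ℕ) :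
    coeff j s = (-1) ^ j * Ring.choose (s - 1) j := by
  induction j with
  | zero => simp [coeff_zero hs]
  | succ j ih =>
    have h := Ring.descPochhammer_eq_factorial_smul_choose (s - 1) (j + 1)
    have h' := Ring.descPochhammer_eq_factorial_smul_choose (s - 1) j
    rw [descPochhammer_succ_right] at h
    simp only [Polynomial.smeval_mul, Polynomial.smeval_sub, Polynomial.smeval_X,
      Polynomial.smeval_natCast, h', Nat.factorial_succ, nsmul_eq_mul] at h
    have hf : (j.factorial : ℝ) ≠ 0 := by positivity
    have hj : ((j : ℝ) + 1) ≠ 0 := by positivity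
    have h2 : Ring.choose (s - 1) j * (s - 1 - j) = (j + 1) * Ring.choose (s - 1) (j + 1) := by
      apply mul_left_cancel₀ hf
      push_cast at h
      simp only [pow_one, pow_zero, mul_one] at h
      linarith
    rw [coeff_succ, ih, pow_succ]
    field_simp
    linear_combination -h2

theorem hasSum_coeff {s : ℝ} (hs : 0 < s) {w : ℝ} (hw : 0 ≤ w) (hw1 : w < 1) :
    HasSum (fun j : ℕ => coeff j s * w ^ j) ((1 - w) ^ (s - 1)) := by
  have h := (Real.one_add_rpow_hasFPowerSeriesOnBall_zero (a := s - 1)).hasSum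
    (y := -w) (by simp [enorm_eq_nnnorm, ← NNReal.coe_lt_coe, abs_of_nonneg hw, hw1])
  simp only [zero_add, binomialSeries_apply] at h
  rw [← sub_eq_add_neg] at h
  refine (funext fun j => ?_ : (fun j : ℕ => coeff j s * w ^ j) = _) ▸ h
  rw [coeff_eq_choose hs, List.ofFn_const, List.prod_replicate, neg_pow, smul_eq_mul]
  ring

/-- In `coeff_succ` the ratio `(j + 1 - s) / (j + 1)` is nonnegative once `j ≥ s`, so the sign no
longer changes. -/
lemma exists_sign_coeff (s : ℝ) :
    ∃ (N : ℕ) (σ : ℝ), ∀ j, N ≤ j → |coeff j s| = σ * coeff j s := by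
  obtain ⟨N, hN⟩ := exists_nat_ge s
  refine ⟨N, SignType.sign (coeff N s), fun j hj => ?_⟩
  induction j, hj using Nat.le_induction with
  | base => exact (sign_mul_self _).symm
  | succ j hj ih =>
    have h : (0 : ℝ) ≤ (j + 1 - s) / (j + 1) := by
      have : (N : ℝ) ≤ j := by exact_mod_cast hj
      exact div_nonneg (by linarith) (by positivity)
    rw [coeff_succ, abs_mul, ih, abs_of_nonneg h, mul_assoc]

/-- The series of absolute values differs from a multiple of `(1 - w) ^ (s - 1)` by a
polynomial. -/
theorem exists_hasSum_abs_coeff {s : ℝ} (hs : 0 < s) :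
    ∃ (N : ℕ) (σ : ℝ) (d : ℕ → ℝ), ∀ w : ℝ, 0 ≤ w → w < 1 →
      HasSum (fun j : ℕ => |coeff j s| * w ^ j)
        (σ * (1 - w) ^ (s - 1) + ∑ j ∈ Finset.range N, d j * w ^ j) := by
  obtain ⟨N, σ, h⟩ := exists_sign_coeff s
  refine ⟨N, σ, fun j => |coeff j s| - σ * coeff j s, fun w hw hw1 => ?_⟩
  have h1 := (hasSum_coeff hs hw hw1).mul_left σ
  have h2 := hasSum_sum_of_ne_finset_zero (s := Finset.range N)
    (L := .unconditional ℕ)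
    (f := fun j => (|coeff j s| - σ * coeff j s) * w ^ j) (fun j hj => by
      simp only [Finset.mem_range, not_lt] at hj
      simp [h j hj])
  refine (funext fun j => ?_ : (fun j : ℕ => |coeff j s| * w ^ j) = _) ▸ h1.add h2
  ring

/-- Dominated convergence with bounds `|coeff j s| * w ^ j * |F|`. Their sum is controlled by the
two integrable functions in the hypotheses. All three expansions of the entropy use this lemma. -/
theorem hasSum_integral_coeff {α : Type*} [MeasurableSpace α] {μ : Measure α} {s : ℝ}
    (hs : 0 < s) {w F : α → ℝ} (hw : AEStronglyMeasurable w μ) (hw01 : ∀ᵐ x ∂μ, 0 ≤ w x ∧ w x < 1)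
    (hF : Integrable F μ) (hF' : Integrable (fun x => (1 - w x) ^ (s - 1) * F x) μ) :
    HasSum (fun j : ℕ => coeff j s * ∫ x, w x ^ j * F x ∂μ)
      (∫ x, (1 - w x) ^ (s - 1) * F x ∂μ) := by
  obtain ⟨N, σ, d, hd⟩ := exists_hasSum_abs_coeff hs
  have hint (j : ℕ) : Integrable (fun x => w x ^ j * F x) μ := by
    refine hF.mono ((hw.pow j).mul hF.1) ?_
    filter_upwards [hw01] with x hx
    rw [norm_mul, norm_pow, Real.norm_of_nonneg hx.1]
    exact mul_le_of_le_one_left (norm_nonneg _) (pow_le_one₀ hx.1 hx.2.le)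
  have key := hasSum_integral_of_dominated_convergence (μ := μ)
    (F := fun j x => coeff j s * (w x ^ j * F x)) (f := fun x => (1 - w x) ^ (s - 1) * F x)
    (fun j x => |coeff j s| * w x ^ j * |F x|) (fun j => ((hint j).const_mul _).1) ?_ ?_ ?_ ?_
  · simpa only [integral_const_mul] using key
  · intro j
    filter_upwards [hw01] with x hx
    rw [norm_mul, norm_mul, norm_pow, Real.norm_of_nonneg hx.1, Real.norm_eq_abs,
      Real.norm_eq_abs, mul_assoc]
  · filter_upwards [hw01] with x hx
    exact (hd _ hx.1 hx.2).summable.mul_right _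
  -- This function is the sum of the bounds, in the closed form of `exists_hasSum_abs_coeff`.
  · have : Integrable (fun x => σ * |(1 - w x) ^ (s - 1) * F x| +
        ∑ j ∈ Finset.range N, d j * |w x ^ j * F x|) μ :=
      (hF'.abs.const_mul σ).add (integrable_finsetSum _ fun j _ => (hint j).abs.const_mul _)
    refine this.congr ?_
    filter_upwards [hw01] with x hx
    rw [((hd _ hx.1 hx.2).mul_right |F x|).tsum_eq, add_mul, Finset.sum_mul, abs_mul,
      abs_of_nonneg (Real.rpow_nonneg (by linarith [hx.2] : (0 : ℝ) ≤ 1 - w x) _), mul_assoc]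
    congr 1
    refine Finset.sum_congr rfl fun j _ => ?_
    rw [abs_mul, abs_of_nonneg (pow_nonneg hx.1 j), mul_assoc]
  · filter_upwards [hw01] with x hx
    simpa only [mul_assoc] using (hasSum_coeff hs hx.1 hx.2).mul_right (F x)


/-! ### Logarithmic singularities on the unit interval -/

/-- A common bound for the logarithmic singularities at the endpoints of `(0, 1)`. -/
noncomputable def logBound (u : ℝ) : ℝ := 1 + |Real.log u| + |Real.log (1 - u)|

lemma one_le_logBound (u : ℝ) : 1 ≤ logBound u := by
  unfold logBound; linarith [abs_nonneg (Real.log u), abs_nonneg (Real.log (1 - u))]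

lemma logBound_nonneg (u : ℝ) : 0 ≤ logBound u := zero_le_one.trans (one_le_logBound u)

lemma abs_log_le_logBound (u : ℝ) : |Real.log u| ≤ logBound u := by
  unfold logBound; linarith [abs_nonneg (Real.log (1 - u))]

lemma abs_log_one_sub_le_logBound (u : ℝ) : |Real.log (1 - u)| ≤ logBound u := by
  unfold logBound; linarith [abs_nonneg (Real.log u)]

lemma measurable_logBound : Measurable logBound := by
  unfold logBound; fun_prop

lemma abs_log_le_rpow {u ε : ℝ} (hu : 0 < u) (hu1 : u ≤ 1) (hε : 0 < ε) :
    |Real.log u| ≤ 1 / ε * u ^ (-ε) := by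
  have h := (Real.abs_log_mul_self_rpow_lt u ε hu hu1 hε).le
  rw [abs_mul, abs_of_pos (Real.rpow_pos_of_pos hu ε)] at h
  rwa [Real.rpow_neg hu.le, ← div_eq_mul_inv, le_div_iff₀ (Real.rpow_pos_of_pos hu ε)]

/-- A logarithm costs an arbitrarily small power, which a beta weight with positive parameters can
absorb. -/
lemma logBound_le {u ε : ℝ} (hu : u ∈ Ioo (0 : ℝ) 1) (hε : 0 < ε) :
    logBound u ≤ (1 + 2 / ε) * (u ^ (-ε) * (1 - u) ^ (-ε)) := by
  have hu' : 0 < 1 - u := by linarith [hu.2]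
  have h1 := abs_log_le_rpow hu.1 hu.2.le hε
  have h2 := abs_log_le_rpow hu' (by linarith [hu.1]) hε
  have h3 : 1 ≤ u ^ (-ε) := Real.one_le_rpow_of_pos_of_le_one_of_nonpos hu.1 hu.2.le (by linarith)
  have h4 : 1 ≤ (1 - u) ^ (-ε) :=
    Real.one_le_rpow_of_pos_of_le_one_of_nonpos hu' (by linarith [hu.1]) (by linarith)
  have h5 : u ^ (-ε) ≤ u ^ (-ε) * (1 - u) ^ (-ε) := le_mul_of_one_le_right (by linarith) h4
  have h6 : (1 - u) ^ (-ε) ≤ u ^ (-ε) * (1 - u) ^ (-ε) := le_mul_of_one_le_left (by linarith) h3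
  have he : 0 ≤ 1 / ε := by positivity
  have h7 := mul_le_mul_of_nonneg_left h5 he
  have h8 := mul_le_mul_of_nonneg_left h6 he
  have : 2 / ε = 1 / ε + 1 / ε := by ring
  unfold logBound
  rw [this]
  linarith

lemma integrableOn_rpow_mul_rpow {p q : ℝ} (hp : 0 < p) (hq : 0 < q) :
    IntegrableOn (fun u : ℝ => u ^ (p - 1) * (1 - u) ^ (q - 1)) (Ioo 0 1) := by
  have h := Complex.betaIntegral_convergent (u := p) (v := q) (by simpa) (by simpa)
  rw [intervalIntegrable_iff_integrableOn_Ioo_of_le zero_le_one] at h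
  refine IntegrableOn.congr_fun h.re (fun u hu => ?_) measurableSet_Ioo
  have h1 : (1 - u : ℂ) = ((1 - u : ℝ) : ℂ) := by push_cast; ring
  have h2 : (p - 1 : ℂ) = ((p - 1 : ℝ) : ℂ) := by push_cast; ring
  have h3 : (q - 1 : ℂ) = ((q - 1 : ℝ) : ℂ) := by push_cast; ring
  simp only [h1, h2, h3]
  rw [← Complex.ofReal_cpow hu.1.le, ← Complex.ofReal_cpow (by linarith [hu.2]),
    ← Complex.ofReal_mul]
  exact Complex.ofReal_re _

lemma integral_rpow_mul_rpow {p q : ℝ} (hp : 0 < p) (hq : 0 < q) :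
    ∫ u in Ioo (0 : ℝ) 1, u ^ (p - 1) * (1 - u) ^ (q - 1) = beta p q := by
  rw [beta_eq_betaIntegralReal p q hp hq, Complex.betaIntegral,
    intervalIntegral.integral_of_le zero_le_one, ← integral_Ioc_eq_integral_Ioo]
  have h := Complex.betaIntegral_convergent (u := p) (v := q) (by simpa) (by simpa)
  rw [intervalIntegrable_iff_integrableOn_Ioc_of_le zero_le_one] at h
  rw [← RCLike.re_to_complex, ← integral_re h]
  refine setIntegral_congr_fun measurableSet_Ioc fun u hu => ?_
  have h1 : (1 - u : ℂ) = ((1 - u : ℝ) : ℂ) := by push_cast; ring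
  have h2 : (p - 1 : ℂ) = ((p - 1 : ℝ) : ℂ) := by push_cast; ring
  have h3 : (q - 1 : ℂ) = ((q - 1 : ℝ) : ℂ) := by push_cast; ring
  simp only [h1, h2, h3]
  rw [← Complex.ofReal_cpow hu.1.le, ← Complex.ofReal_cpow (by linarith [hu.2]),
    ← Complex.ofReal_mul]
  exact (Complex.ofReal_re _).symm

lemma integrableOn_rpow_mul_rpow_mul_logBound {p q : ℝ} (hp : 0 < p) (hq : 0 < q) :
    IntegrableOn (fun u : ℝ => u ^ (p - 1) * (1 - u) ^ (q - 1) * logBound u) (Ioo 0 1) := by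
  -- With `ε < min p q` the parameters `p - ε` and `q - ε` remain positive.
  obtain ⟨ε, hε, hεm⟩ := exists_between (lt_min hp hq)
  have hεp : ε < p := hεm.trans_le (min_le_left _ _)
  have hεq : ε < q := hεm.trans_le (min_le_right _ _)
  have h := (integrableOn_rpow_mul_rpow (sub_pos.2 hεp) (sub_pos.2 hεq)).const_mul (1 + 2 / ε)
  have hm := measurable_logBound
  refine h.mono' (Measurable.aestronglyMeasurable (by fun_prop)) ?_
  filter_upwards [ae_restrict_mem measurableSet_Ioo] with u hu
  have hu' : 0 < 1 - u := by linarith [hu.2]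
  have hp' := Real.rpow_pos_of_pos hu.1 (p - 1)
  have hq' := Real.rpow_pos_of_pos hu' (q - 1)
  rw [Real.norm_of_nonneg (mul_nonneg (mul_pos hp' hq').le (logBound_nonneg u))]
  refine (mul_le_mul_of_nonneg_left (logBound_le hu hε) (mul_pos hp' hq').le).trans_eq ?_
  rw [show p - ε - 1 = (p - 1) + -ε by ring, show q - ε - 1 = (q - 1) + -ε by ring,
    Real.rpow_add hu.1, Real.rpow_add hu']
  ring

/-- A function bounded by a multiple of `logBound` is integrable against every beta weight. -/
lemma integrableOn_of_abs_le_logBound {p q K : ℝ} (hp : 0 < p) (hq : 0 < q) {F : ℝ → ℝ}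
    (hF : Measurable F)
    (h : ∀ u ∈ Ioo (0 : ℝ) 1, |F u| ≤ K * (u ^ (p - 1) * (1 - u) ^ (q - 1) * logBound u)) :
    IntegrableOn F (Ioo 0 1) := by
  refine ((integrableOn_rpow_mul_rpow_mul_logBound hp hq).const_mul K).mono'
    hF.aestronglyMeasurable ?_
  filter_upwards [ae_restrict_mem measurableSet_Ioo] with u hu
  exact h u hu

/-! ### Logarithmic integrals -/

lemma hasDerivAt_Gamma {x : ℝ} (hx : 0 < x) :
    HasDerivAt Real.Gamma (Real.Gamma x * digamma x) x := by
  have h : DifferentiableAt ℝ Real.Gamma x := Real.differentiableAt_Gamma fun m => by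
    have : (0 : ℝ) ≤ m := m.cast_nonneg
    linarith
  refine h.hasDerivAt.congr_deriv ?_
  rw [digamma, mul_div_cancel₀ _ (Real.Gamma_pos_of_pos hx).ne']

lemma digamma_add_one {x : ℝ} (hx : 0 < x) : digamma (x + 1) = digamma x + 1 / x := by
  have h1 : HasDerivAt (fun y => Real.Gamma (y + 1))
      (Real.Gamma (x + 1) * digamma (x + 1)) x :=
    (hasDerivAt_Gamma (by linarith : 0 < x + 1)).comp_add_const x 1
  have h2 : HasDerivAt (fun y => y * Real.Gamma y)
      (1 * Real.Gamma x + x * (Real.Gamma x * digamma x)) x :=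
    (hasDerivAt_id x).mul (hasDerivAt_Gamma hx)
  have h3 : (fun y => Real.Gamma (y + 1)) =ᶠ[𝓝 x] fun y => y * Real.Gamma y := by
    filter_upwards [lt_mem_nhds hx] with y hy
    exact Real.Gamma_add_one hy.ne'
  have h4 := h1.unique (h2.congr_of_eventuallyEq h3)
  rw [Real.Gamma_add_one hx.ne'] at h4
  have hG := (Real.Gamma_pos_of_pos hx).ne'
  field_simp at h4 ⊢
  linarith

lemma hasDerivAt_beta {p q : ℝ} (hp : 0 < p) (hq : 0 < q) :
    HasDerivAt (fun y => beta p y) (beta p q * (digamma q - digamma (p + q))) q := by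
  have hG := (Real.Gamma_pos_of_pos (add_pos hp hq)).ne'
  have h1 := (hasDerivAt_Gamma hq).const_mul (Real.Gamma p)
  have h2 := (hasDerivAt_Gamma (add_pos hp hq)).comp_const_add p q
  refine (h1.div h2 hG).congr_deriv ?_
  unfold beta
  field_simp

/-- Differentiation of the beta integral under the integral sign in its second parameter, compared
with `hasDerivAt_beta`. -/
theorem integral_rpow_mul_rpow_mul_log {p q : ℝ} (hp : 0 < p) (hq : 0 < q) :
    ∫ u in Ioo (0 : ℝ) 1, u ^ (p - 1) * (1 - u) ^ (q - 1) * Real.log (1 - u) =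
      beta p q * (digamma q - digamma (p + q)) := by
  -- For `y > q / 2` the factor `(1 - u) ^ (y - 1)` is at most `(1 - u) ^ (q / 2 - 1)`, a bound
  -- uniform in `y`.
  have hs : Ioi (q / 2) ∈ 𝓝 q := Ioi_mem_nhds (by linarith)
  have h := (hasDerivAt_integral_of_dominated_loc_of_deriv_le
    (μ := volume.restrict (Ioo (0 : ℝ) 1))
    (F := fun y u => u ^ (p - 1) * (1 - u) ^ (y - 1))
    (F' := fun y u => u ^ (p - 1) * (1 - u) ^ (y - 1) * Real.log (1 - u))
    (bound := fun u => u ^ (p - 1) * (1 - u) ^ (q / 2 - 1) * logBound u) hs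
    (Eventually.of_forall fun y => Measurable.aestronglyMeasurable (by fun_prop))
    (integrableOn_rpow_mul_rpow hp hq) (Measurable.aestronglyMeasurable (by fun_prop)) ?_
    (integrableOn_rpow_mul_rpow_mul_logBound hp (half_pos hq)) ?_).2
  · refine h.unique ((hasDerivAt_beta hp hq).congr_of_eventuallyEq ?_)
    filter_upwards [lt_mem_nhds hq] with y hy
    exact integral_rpow_mul_rpow hp hy
  · filter_upwards [ae_restrict_mem measurableSet_Ioo] with u hu y hy
    have hu' : 0 < 1 - u := by linarith [hu.2]
    have hp' := Real.rpow_pos_of_pos hu.1 (p - 1)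
    have hq' := Real.rpow_pos_of_pos hu' (y - 1)
    rw [norm_mul, Real.norm_of_nonneg (mul_pos hp' hq').le]
    have hy' : q / 2 < y := hy
    exact mul_le_mul (mul_le_mul_of_nonneg_left (Real.rpow_le_rpow_of_exponent_ge hu'
      (by linarith [hu.1]) (by linarith)) hp'.le) (abs_log_one_sub_le_logBound u) (norm_nonneg _)
      (mul_pos hp' (Real.rpow_pos_of_pos hu' _)).le
  · filter_upwards [ae_restrict_mem measurableSet_Ioo] with u hu y _
    have hu' : 0 < 1 - u := by linarith [hu.2]
    have h1 : HasDerivAt (fun y : ℝ => (1 - u) ^ (y - 1))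
        ((1 - u) ^ (y - 1) * Real.log (1 - u)) y := by
      simpa using (Real.hasStrictDerivAt_const_rpow hu' (y - 1)).hasDerivAt.comp_sub_const y 1
    simpa only [mul_assoc] using h1.const_mul (u ^ (p - 1))

lemma beta_one_right {p : ℝ} (hp : 0 < p) : beta p 1 = 1 / p := by
  have := (Real.Gamma_pos_of_pos hp).ne'
  rw [beta, Real.Gamma_add_one hp.ne', Real.Gamma_one]
  field_simp

lemma integral_rpow_mul_log_one_sub {p : ℝ} (hp : 0 < p) :
    ∫ u in Ioo (0 : ℝ) 1, u ^ (p - 1) * Real.log (1 - u) =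
      1 / p * (digamma 1 - digamma (p + 1)) := by
  simpa [beta_one_right hp] using integral_rpow_mul_rpow_mul_log hp one_pos

lemma integral_pow_mul_log_one_sub (j : ℕ) :
    ∫ u in Ioo (0 : ℝ) 1, u ^ j * Real.log (1 - u) =
      1 / (j + 1) * (digamma 1 - digamma (j + 2)) := by
  have h := integral_rpow_mul_log_one_sub (p := (j : ℝ) + 1) (by positivity)
  simp only [add_sub_cancel_right, Real.rpow_natCast] at h
  rw [h]
  norm_num [add_assoc]

lemma integral_comp_one_sub_Ioo (F : ℝ → ℝ) :
    ∫ u in Ioo (0 : ℝ) 1, F (1 - u) = ∫ u in Ioo (0 : ℝ) 1, F u := by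
  have h := intervalIntegral.integral_comp_sub_left (a := 0) (b := 1) F 1
  simpa [intervalIntegral.integral_of_le, integral_Ioc_eq_integral_Ioo] using h

/-- After `u ↦ 1 - u` this is the beta case `p = 1`, `q = j + 1`, where the digamma difference
collapses to `-1 / (j + 1)`. -/
lemma integral_pow_mul_log (j : ℕ) :
    ∫ u in Ioo (0 : ℝ) 1, u ^ j * Real.log u = -(1 / ((j : ℝ) + 1) ^ 2) := by
  have hj : (0 : ℝ) < j + 1 := by positivity
  have h := integral_rpow_mul_rpow_mul_log one_pos hj
  simp only [sub_self, Real.rpow_zero, one_mul, add_sub_cancel_right, Real.rpow_natCast] at h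
  rw [integral_comp_one_sub_Ioo (fun u => u ^ j * Real.log u)] at h
  rw [h, add_comm 1 ((j : ℝ) + 1), digamma_add_one hj, beta, mul_comm (Real.Gamma 1),
    add_comm 1 ((j : ℝ) + 1), ← beta, beta_one_right hj]
  field_simp
  ring

/-! ### Substitutions -/

lemma image_rpow_Ioo {c : ℝ} (hc : 0 < c) : (fun v : ℝ => v ^ c) '' Ioo 0 1 = Ioo 0 1 := by
  ext w
  constructor
  · rintro ⟨v, hv, rfl⟩
    exact ⟨Real.rpow_pos_of_pos hv.1 c, Real.rpow_lt_one hv.1.le hv.2 hc⟩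
  · intro hw
    refine ⟨w ^ c⁻¹, ⟨Real.rpow_pos_of_pos hw.1 _, Real.rpow_lt_one hw.1.le hw.2 (by positivity)⟩,
      Real.rpow_inv_rpow hw.1.le hc.ne'⟩

lemma integral_comp_rpow_Ioo {c : ℝ} (hc : 0 < c) (F : ℝ → ℝ) :
    ∫ v in Ioo (0 : ℝ) 1, c * v ^ (c - 1) * F (v ^ c) = ∫ w in Ioo (0 : ℝ) 1, F w := by
  have h := integral_image_eq_integral_abs_deriv_smul (s := Ioo (0 : ℝ) 1) (f := fun v => v ^ c)
    (f' := fun v => c * v ^ (c - 1)) measurableSet_Ioo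
    (fun v hv => (Real.hasDerivAt_rpow_const (Or.inl hv.1.ne')).hasDerivWithinAt)
    (fun v hv w hw hvw => (Real.rpow_left_inj hv.1.le hw.1.le hc.ne').1 hvw) F
  rw [image_rpow_Ioo hc] at h
  rw [h]
  refine setIntegral_congr_fun measurableSet_Ioo fun v hv => ?_
  have := Real.rpow_pos_of_pos hv.1 (c - 1)
  simp only [smul_eq_mul]
  rw [abs_of_pos (by positivity)]

/-- The substitution `w = v ^ c` gives `integral_rpow_mul_log_one_sub` with `p = (i + 1) / c`. -/
lemma integral_pow_mul_log_one_sub_rpow {c : ℝ} (hc : 0 < c) (i : ℕ) :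
    ∫ v in Ioo (0 : ℝ) 1, v ^ i * Real.log (1 - v ^ c) =
      1 / (i + 1) * (digamma 1 - digamma ((i + 1) / c + 1)) := by
  have hi : (0 : ℝ) < (i + 1) / c := by positivity
  have h := integral_rpow_mul_log_one_sub hi
  rw [← integral_comp_rpow_Ioo hc] at h
  have h2 : ∀ v ∈ Ioo (0 : ℝ) 1, c * v ^ (c - 1) *
      ((v ^ c) ^ (((i : ℝ) + 1) / c - 1) * Real.log (1 - v ^ c)) =
        c * (v ^ i * Real.log (1 - v ^ c)) := by
    intro v hv
    have : v ^ (c - 1) * (v ^ c) ^ (((i : ℝ) + 1) / c - 1) = v ^ i := by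
      rw [← Real.rpow_mul hv.1.le, ← Real.rpow_add hv.1, ← Real.rpow_natCast]
      congr 1
      field_simp
      ring
    rw [← this]
    ring
  rw [setIntegral_congr_fun measurableSet_Ioo h2, integral_const_mul] at h
  have h3 : 1 / (((i : ℝ) + 1) / c) = c * (1 / (i + 1)) := by field_simp
  rw [h3, mul_assoc] at h
  exact mul_left_cancel₀ hc.ne' h

/-- From below, `-log u ≥ 1 - u`; from above, `log y ≤ y - 1` at `y = -log u`. -/
lemma abs_log_neg_log_le_logBound {u : ℝ} (hu : u ∈ Ioo (0 : ℝ) 1) :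
    |Real.log (-Real.log u)| ≤ logBound u := by
  have hu' : 0 < 1 - u := by linarith [hu.2]
  have h1 : 1 - u ≤ -Real.log u := by linarith [Real.log_le_sub_one_of_pos hu.1]
  have h2 := Real.log_le_log hu' h1
  have h3 := Real.log_le_sub_one_of_pos (hu'.trans_le h1)
  have h4 := neg_abs_le (Real.log (1 - u))
  have h5 := neg_abs_le (Real.log u)
  rw [abs_le]
  unfold logBound
  constructor <;> linarith [abs_nonneg (Real.log u), abs_nonneg (Real.log (1 - u))]

lemma integrableOn_log_neg_log :
    IntegrableOn (fun u => Real.log (-Real.log u)) (Ioo 0 1) :=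
  integrableOn_of_abs_le_logBound (K := 1) one_pos one_pos (by fun_prop) fun u hu => by
    simpa using abs_log_neg_log_le_logBound hu

lemma deriv_Gamma_one_eq_integral :
    deriv Real.Gamma 1 = ∫ t in Ioi (0 : ℝ), Real.exp (-t) * Real.log t := by
  have h1 : HasDerivAt Complex.Gamma (∫ t : ℝ in Ioi 0, (t : ℂ) ^ ((1 : ℂ) - 1) *
      (Real.log t * Real.exp (-t))) ((1 : ℝ) : ℂ) := by
    refine (Complex.ofReal_one ▸
      Complex.hasDerivAt_GammaIntegral (s := 1) (by simp)).congr_of_eventuallyEq ?_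
    have : IsOpen {s : ℂ | 0 < s.re} := Complex.continuous_re.isOpen_preimage _ isOpen_Ioi
    filter_upwards [this.mem_nhds (by simp : (((1 : ℝ) : ℂ)) ∈ {s : ℂ | 0 < s.re})] with s hs
    exact Complex.Gamma_eq_integral hs
  have h2 := h1.real_of_complex.deriv
  have h3 : ∫ t : ℝ in Ioi 0, (t : ℂ) ^ ((1 : ℂ) - 1) * (Real.log t * Real.exp (-t)) =
      ((∫ t in Ioi (0 : ℝ), Real.exp (-t) * Real.log t : ℝ) : ℂ) := by
    rw [← integral_complex_ofReal]
    refine integral_congr_ae (Eventually.of_forall fun t => ?_)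
    simp [mul_comm]
  rw [h3, Complex.ofReal_re] at h2
  exact h2

lemma image_exp_neg_Ioi : (fun t : ℝ => Real.exp (-t)) '' Ioi 0 = Ioo 0 1 := by
  ext u
  constructor
  · rintro ⟨t, ht, rfl⟩
    exact ⟨Real.exp_pos _, Real.exp_lt_one_iff.2 (neg_lt_zero.2 ht)⟩
  · intro hu
    exact ⟨-Real.log u, neg_pos.2 (Real.log_neg hu.1 hu.2), by simp [Real.exp_log hu.1]⟩

lemma integral_log_neg_log :
    ∫ u in Ioo (0 : ℝ) 1, Real.log (-Real.log u) = deriv Real.Gamma 1 := by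
  have h := integral_image_eq_integral_abs_deriv_smul (s := Ioi (0 : ℝ))
    (f := fun t => Real.exp (-t)) (f' := fun t => -Real.exp (-t)) measurableSet_Ioi
    (fun t _ => by simpa using ((hasDerivAt_neg t).exp).hasDerivWithinAt)
    (fun s _ t _ hst => neg_injective (Real.exp_injective hst)) fun u => Real.log (-Real.log u)
  rw [image_exp_neg_Ioi] at h
  simpa [deriv_Gamma_one_eq_integral, abs_of_pos (Real.exp_pos _)] using h

/-- Replacing `u` by `u ^ (j + 1)` adds `log (j + 1)` to `log (-log u)`; the case `j = 0` is
`Γ'(1)`, by `u = exp (-t)`. -/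
lemma integral_pow_mul_log_neg_log (j : ℕ) :
    ∫ u in Ioo (0 : ℝ) 1, u ^ j * Real.log (-Real.log u) =
      (deriv Real.Gamma 1 - Real.log (j + 1)) / (j + 1) := by
  have hj : (0 : ℝ) < j + 1 := by positivity
  have h := integral_comp_rpow_Ioo hj fun u => Real.log (-Real.log u) - Real.log (j + 1)
  have h2 : ∀ u ∈ Ioo (0 : ℝ) 1, ((j : ℝ) + 1) * u ^ ((j : ℝ) + 1 - 1) *
      (Real.log (-Real.log (u ^ ((j : ℝ) + 1))) - Real.log (j + 1)) =
        (j + 1) * (u ^ j * Real.log (-Real.log u)) := by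
    intro u hu
    have hl : -Real.log u ≠ 0 := (neg_pos.2 (Real.log_neg hu.1 hu.2)).ne'
    rw [Real.log_rpow hu.1, ← mul_neg, Real.log_mul hj.ne' hl, add_sub_cancel_right,
      Real.rpow_natCast]
    ring
  rw [setIntegral_congr_fun measurableSet_Ioo h2, integral_const_mul,
    integral_sub integrableOn_log_neg_log (by simp), integral_log_neg_log] at h
  rw [eq_div_iff hj.ne', mul_comm, h]
  simp


/-! ### Behaviour of `1 - (1 - u) ^ c` -/

/-- Bernoulli's inequality if `c ≤ 1`, monotonicity in the exponent otherwise. Together with the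
upper bound below, `1 - (1 - u) ^ c` is comparable to `u`. -/
lemma min_mul_le_one_sub_rpow {c u : ℝ} (hc : 0 < c) (hu : u ∈ Ioo (0 : ℝ) 1) :
    min 1 c * u ≤ 1 - (1 - u) ^ c := by
  rcases le_total 1 c with h | h
  · have := Real.rpow_le_rpow_of_exponent_ge (by linarith [hu.2] : 0 < 1 - u)
      (by linarith [hu.1]) h
    rw [Real.rpow_one] at this
    rw [min_eq_left h]
    linarith
  · have := rpow_one_add_le_one_add_mul_self (s := -u) (by linarith [hu.2]) hc.le h
    rw [← sub_eq_add_neg] at this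
    rw [min_eq_right h]
    linarith

lemma one_sub_rpow_le_max_mul {c u : ℝ} (hu : u ∈ Ioo (0 : ℝ) 1) :
    1 - (1 - u) ^ c ≤ max 1 c * u := by
  rcases le_total 1 c with h | h
  · have := one_add_mul_self_le_rpow_one_add (s := -u) (by linarith [hu.2]) h
    rw [← sub_eq_add_neg] at this
    rw [max_eq_right h]
    linarith
  · have := Real.rpow_le_rpow_of_exponent_ge (by linarith [hu.2] : 0 < 1 - u)
      (by linarith [hu.1]) h
    rw [Real.rpow_one] at this
    rw [max_eq_left h]
    linarith

lemma one_sub_rpow_mem_Ioo {c u : ℝ} (hc : 0 < c) (hu : u ∈ Ioo (0 : ℝ) 1) :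
    1 - (1 - u) ^ c ∈ Ioo (0 : ℝ) 1 := by
  have hu' : 0 < 1 - u := by linarith [hu.2]
  have h1 := Real.rpow_pos_of_pos hu' c
  have h2 := Real.rpow_lt_one hu'.le (by linarith [hu.1]) hc
  constructor <;> linarith

lemma abs_log_one_sub_rpow_le {c u : ℝ} (hc : 0 < c) (hu : u ∈ Ioo (0 : ℝ) 1) :
    |Real.log (1 - (1 - u) ^ c)| ≤ (|Real.log (min 1 c)| + 1) * logBound u := by
  have hm : 0 < min 1 c := lt_min one_pos hc
  have hy := one_sub_rpow_mem_Ioo hc hu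
  have h1 := Real.log_le_log (mul_pos hm hu.1) (min_mul_le_one_sub_rpow hc hu)
  rw [Real.log_mul hm.ne' hu.1.ne'] at h1
  have h2 := neg_abs_le (Real.log (min 1 c))
  have h3 := neg_abs_le (Real.log u)
  have h4 := abs_log_le_logBound u
  have h5 := mul_le_mul_of_nonneg_left (one_le_logBound u) (abs_nonneg (Real.log (min 1 c)))
  rw [abs_of_neg (Real.log_neg hy.1 hy.2)]
  linarith

lemma one_sub_rpow_rpow_le {b c u : ℝ} (hc : 0 < c) (hu : u ∈ Ioo (0 : ℝ) 1) :
    (1 - (1 - u) ^ c) ^ (b - 1) ≤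
      (min 1 c ^ (b - 1) + max 1 c ^ (b - 1)) * u ^ (b - 1) := by
  have hm : 0 < min 1 c := lt_min one_pos hc
  have hM : 0 < max 1 c := one_pos.trans_le (le_max_left _ _)
  have hy := one_sub_rpow_mem_Ioo hc hu
  have hmp := (mul_pos (Real.rpow_pos_of_pos hm (b - 1)) (Real.rpow_pos_of_pos hu.1 (b - 1))).le
  have hMp := (mul_pos (Real.rpow_pos_of_pos hM (b - 1)) (Real.rpow_pos_of_pos hu.1 (b - 1))).le
  rw [add_mul]
  -- The sign of `b - 1` decides which of the two linear bounds applies; the sum of the constants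
  -- covers both cases.
  rcases le_total 1 b with h | h
  · have := Real.rpow_le_rpow hy.1.le (one_sub_rpow_le_max_mul hu) (sub_nonneg.2 h)
    rw [Real.mul_rpow hM.le hu.1.le] at this
    linarith
  · have := Real.rpow_le_rpow_of_nonpos (mul_pos hm hu.1) (min_mul_le_one_sub_rpow hc hu)
      (sub_nonpos.2 h)
    rw [Real.mul_rpow hm.le hu.1.le] at this
    linarith

/-! ### The logarithm of the density in the variable `u = G(x)` -/

/-- The negative logarithm of the density at `x`, up to the constant `log (c θ γ / B(a, b))`, as a
function of `u = G(x)`. -/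
noncomputable def logTerm (γ θ a b c u : ℝ) : ℝ :=
  -((θ + 1) / θ * (Real.log (-Real.log u) - Real.log γ)) - (a * c - 1) * Real.log (1 - u)
    - Real.log u - (b - 1) * Real.log (1 - (1 - u) ^ c)

/-- The density of `G(X)` on `(0, 1)`, up to the constant `c / B(a, b)`. -/
noncomputable def unitWeight (a b c u : ℝ) : ℝ :=
  (1 - (1 - u) ^ c) ^ (b - 1) * (1 - u) ^ (a * c - 1)

lemma measurable_logTerm (γ θ a b c : ℝ) : Measurable (logTerm γ θ a b c) := by
  unfold logTerm; fun_prop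

lemma measurable_unitWeight (a b c : ℝ) : Measurable (unitWeight a b c) := by
  unfold unitWeight; fun_prop

lemma exists_abs_logTerm_le (γ θ a b : ℝ) {c : ℝ} (hc : 0 < c) :
    ∃ K, ∀ u ∈ Ioo (0 : ℝ) 1, |logTerm γ θ a b c u| ≤ K * logBound u := by
  refine ⟨|(θ + 1) / θ| * (1 + |Real.log γ|) + |a * c - 1| + 1 +
    |b - 1| * (|Real.log (min 1 c)| + 1), fun u hu => ?_⟩
  have h0 := abs_log_neg_log_le_logBound hu
  have h1 := mul_le_mul_of_nonneg_left (one_le_logBound u) (abs_nonneg (Real.log γ))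
  have h2 : |-((θ + 1) / θ * (Real.log (-Real.log u) - Real.log γ))| ≤
      |(θ + 1) / θ| * (1 + |Real.log γ|) * logBound u := by
    rw [abs_neg, abs_mul, mul_assoc]
    refine mul_le_mul_of_nonneg_left ((abs_sub _ _).trans ?_) (abs_nonneg _)
    linarith
  have h3 : |(a * c - 1) * Real.log (1 - u)| ≤ |a * c - 1| * logBound u := by
    rw [abs_mul]
    exact mul_le_mul_of_nonneg_left (abs_log_one_sub_le_logBound u) (abs_nonneg _)
  have h4 := abs_log_le_logBound u
  have h5 : |(b - 1) * Real.log (1 - (1 - u) ^ c)| ≤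
      |b - 1| * (|Real.log (min 1 c)| + 1) * logBound u := by
    rw [abs_mul, mul_assoc]
    exact mul_le_mul_of_nonneg_left (abs_log_one_sub_rpow_le hc hu) (abs_nonneg _)
  unfold logTerm
  refine (abs_sub _ _).trans ?_
  refine (add_le_add_left (abs_sub _ _) _).trans ?_
  refine (add_le_add_left (add_le_add_left (abs_sub _ _) _) _).trans ?_
  linarith

lemma integrableOn_rpow_mul_logTerm (γ θ a b : ℝ) {c q : ℝ} (hc : 0 < c) (hq : 0 < q) :
    IntegrableOn (fun u => (1 - u) ^ (q - 1) * logTerm γ θ a b c u) (Ioo 0 1) := by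
  obtain ⟨K, hK⟩ := exists_abs_logTerm_le γ θ a b hc
  have hm := measurable_logTerm γ θ a b c
  refine integrableOn_of_abs_le_logBound (K := K) one_pos hq (by fun_prop) fun u hu => ?_
  have hq' := Real.rpow_pos_of_pos (by linarith [hu.2] : 0 < 1 - u) (q - 1)
  rw [abs_mul, abs_of_pos hq', sub_self, Real.rpow_zero, one_mul]
  refine (mul_le_mul_of_nonneg_left (hK u hu) hq'.le).trans_eq ?_
  ring

lemma integrableOn_unitWeight_mul {a b c K : ℝ} (ha : 0 < a) (hb : 0 < b) (hc : 0 < c)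
    {F : ℝ → ℝ} (hF : Measurable F) (hK : ∀ u ∈ Ioo (0 : ℝ) 1, |F u| ≤ K * logBound u) :
    IntegrableOn (fun u => unitWeight a b c u * F u) (Ioo 0 1) := by
  have hm := measurable_unitWeight a b c
  refine integrableOn_of_abs_le_logBound
    (K := (min 1 c ^ (b - 1) + max 1 c ^ (b - 1)) * K) hb (mul_pos ha hc) (by fun_prop)
    fun u hu => ?_
  have hu' : 0 < 1 - u := by linarith [hu.2]
  have hq := Real.rpow_pos_of_pos hu' (a * c - 1)
  have hy := Real.rpow_pos_of_pos (one_sub_rpow_mem_Ioo hc hu).1 (b - 1)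
  have h := one_sub_rpow_rpow_le (b := b) hc hu
  rw [unitWeight, abs_mul, abs_of_pos (mul_pos hy hq)]
  refine (mul_le_mul (mul_le_mul_of_nonneg_right h hq.le) (hK u hu) (abs_nonneg _)
    (mul_nonneg (hy.le.trans h) hq.le)).trans_eq ?_
  ring

lemma integrableOn_log_one_sub_rpow {c : ℝ} (hc : 0 < c) :
    IntegrableOn (fun v : ℝ => Real.log (1 - v ^ c)) (Ioo 0 1) := by
  refine integrableOn_of_abs_le_logBound (K := |Real.log (min 1 c)| + 1) one_pos one_pos
    (by fun_prop) fun v hv => ?_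
  have hv' : 1 - v ∈ Ioo (0 : ℝ) 1 := ⟨by linarith [hv.2], by linarith [hv.1]⟩
  have h := abs_log_one_sub_rpow_le hc hv'
  have hs : logBound (1 - v) = logBound v := by
    unfold logBound; rw [sub_sub_cancel]; ring
  rw [hs, sub_sub_cancel] at h
  simpa using h

/-! ### Term-by-term integration of the three series -/

lemma integrableOn_pow_mul {F : ℝ → ℝ} (hF : IntegrableOn F (Ioo 0 1)) (j : ℕ) :
    IntegrableOn (fun u => u ^ j * F u) (Ioo 0 1) := by
  refine Integrable.mono hF ((continuous_pow j).aestronglyMeasurable.mul hF.1) ?_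
  filter_upwards [ae_restrict_mem measurableSet_Ioo] with u hu
  rw [norm_mul, norm_pow, Real.norm_of_nonneg hu.1.le]
  exact mul_le_of_le_one_left (norm_nonneg _) (pow_le_one₀ hu.1.le hu.2.le)

lemma ae_restrict_Ioo_mem :
    ∀ᵐ u : ℝ ∂volume.restrict (Ioo 0 1), u ∈ Ioo (0 : ℝ) 1 :=
  ae_restrict_mem measurableSet_Ioo

/-- With `v = 1 - u`, the power `u ^ j = (1 - v) ^ j` is expanded in `v`. This is the finite
binomial formula, as `coeff i (j + 1) = 0` for `i > j`. -/
theorem hasSum_innerTerm {c : ℝ} (hc : 0 < c) (j : ℕ) :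
    HasSum (innerTerm c j) (∫ u in Ioo (0 : ℝ) 1, u ^ j * Real.log (1 - (1 - u) ^ c)) := by
  have hF := integrableOn_log_one_sub_rpow hc
  have hF' : IntegrableOn (fun v : ℝ => (1 - v) ^ ((j : ℝ) + 1 - 1) * Real.log (1 - v ^ c))
      (Ioo 0 1) := by
    refine Integrable.mono hF (Measurable.aestronglyMeasurable (by fun_prop)) ?_
    filter_upwards [ae_restrict_Ioo_mem] with u hu
    have hu' : 0 ≤ 1 - u := by linarith [hu.2]
    rw [add_sub_cancel_right, Real.rpow_natCast, norm_mul, norm_pow, Real.norm_of_nonneg hu']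
    exact mul_le_of_le_one_left (norm_nonneg _) (pow_le_one₀ hu' (by linarith [hu.1]))
  have h := hasSum_integral_coeff (s := (j : ℝ) + 1) (by positivity) (w := fun v => v)
    (F := fun v : ℝ => Real.log (1 - v ^ c)) (Measurable.aestronglyMeasurable (by fun_prop))
    (ae_restrict_Ioo_mem.mono fun u hu => ⟨hu.1.le, hu.2⟩) hF hF'
  have e : ∫ v in Ioo (0 : ℝ) 1, (1 - v) ^ ((j : ℝ) + 1 - 1) * Real.log (1 - v ^ c) =
      ∫ u in Ioo (0 : ℝ) 1, u ^ j * Real.log (1 - (1 - u) ^ c) := by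
    rw [← integral_comp_one_sub_Ioo]
    simp
  rw [e] at h
  refine (funext fun i => ?_ : innerTerm c j = _) ▸ h
  rw [integral_pow_mul_log_one_sub_rpow hc, innerTerm]
  ring

theorem integral_pow_mul_logTerm {γ c : ℝ} (θ a b : ℝ) (hγ : 0 < γ) (hc : 0 < c) (j : ℕ) :
    ∫ u in Ioo (0 : ℝ) 1, u ^ j * logTerm γ θ a b c u =
      (θ + 1) / θ * ((Real.log ((j + 1) * γ) - deriv Real.Gamma 1) / (j + 1))
      - (a * c - 1) / (j + 1) * (digamma 1 - digamma (j + 2))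
      + 1 / ((j : ℝ) + 1) ^ 2
      - (b - 1) * ∑' i : ℕ, innerTerm c j i := by
  have hj : (j : ℝ) + 1 ≠ 0 := by positivity
  have i1 := integrableOn_pow_mul integrableOn_log_neg_log j
  have i2 : IntegrableOn (fun u : ℝ => u ^ j) (Ioo 0 1) := by
    simpa using integrableOn_pow_mul (F := fun _ => 1) (by simp) j
  have i3 : IntegrableOn (fun u : ℝ => u ^ j * Real.log (1 - u)) (Ioo 0 1) :=
    integrableOn_pow_mul (by simpa using integrableOn_log_one_sub_rpow one_pos) j
  have i4 : IntegrableOn (fun u : ℝ => u ^ j * Real.log u) (Ioo 0 1) :=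
    integrableOn_pow_mul (integrableOn_of_abs_le_logBound (K := 1) one_pos one_pos (by fun_prop)
      fun u _ => by simpa using abs_log_le_logBound u) j
  have i5 : IntegrableOn (fun u : ℝ => u ^ j * Real.log (1 - (1 - u) ^ c)) (Ioo 0 1) :=
    integrableOn_pow_mul (integrableOn_of_abs_le_logBound (K := |Real.log (min 1 c)| + 1)
      one_pos one_pos (by fun_prop) fun u hu => by simpa using abs_log_one_sub_rpow_le hc hu) j
  have e2 : ∫ u in Ioo (0 : ℝ) 1, u ^ j = 1 / ((j : ℝ) + 1) := by
    rw [← integral_Ioc_eq_integral_Ioo, ← intervalIntegral.integral_of_le zero_le_one]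
    simp
  have e : ∀ u : ℝ, u ^ j * logTerm γ θ a b c u =
      (θ + 1) / θ * Real.log γ * u ^ j - (θ + 1) / θ * (u ^ j * Real.log (-Real.log u))
      - (a * c - 1) * (u ^ j * Real.log (1 - u)) - u ^ j * Real.log u
      - (b - 1) * (u ^ j * Real.log (1 - (1 - u) ^ c)) := fun u => by
    unfold logTerm; ring
  simp only [e]
  have k1 : IntegrableOn (fun u => (θ + 1) / θ * Real.log γ * u ^ j
      - (θ + 1) / θ * (u ^ j * Real.log (-Real.log u))) (Ioo 0 1) :=
    (i2.const_mul _).sub (i1.const_mul _)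
  have k2 : IntegrableOn (fun u => (θ + 1) / θ * Real.log γ * u ^ j
      - (θ + 1) / θ * (u ^ j * Real.log (-Real.log u))
      - (a * c - 1) * (u ^ j * Real.log (1 - u))) (Ioo 0 1) := k1.sub (i3.const_mul _)
  have k3 : IntegrableOn (fun u => (θ + 1) / θ * Real.log γ * u ^ j
      - (θ + 1) / θ * (u ^ j * Real.log (-Real.log u))
      - (a * c - 1) * (u ^ j * Real.log (1 - u)) - u ^ j * Real.log u) (Ioo 0 1) := k2.sub i4
  rw [integral_sub k3 (i5.const_mul _), integral_sub k2 i4, integral_sub k1 (i3.const_mul _),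
    integral_sub (i2.const_mul _) (i1.const_mul _)]
  simp only [integral_const_mul]
  rw [e2, integral_pow_mul_log_neg_log, integral_pow_mul_log_one_sub, integral_pow_mul_log,
    (hasSum_innerTerm hc j).tsum_eq, Real.log_mul hj hγ.ne']
  ring

/-- The `j₁`-th power of `(1 - u) ^ c` merges with `(1 - u) ^ (a c - 1)` into exponent `s - 1` for
`s = c (a + j₁) > 0`, which is then expanded in `u`. -/
theorem hasSum_doubleTerm {γ a c : ℝ} (θ b : ℝ) (hγ : 0 < γ) (ha : 0 < a) (hc : 0 < c) (j₁ : ℕ) :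
    HasSum (doubleTerm γ θ a b c j₁) (coeff j₁ b * ∫ u in Ioo (0 : ℝ) 1,
      ((1 - u) ^ c) ^ j₁ * ((1 - u) ^ (a * c - 1) * logTerm γ θ a b c u)) := by
  have hs : 0 < c * (a + j₁) := by positivity
  have hF := integrableOn_rpow_mul_logTerm γ θ a b hc one_pos
  simp only [sub_self, Real.rpow_zero, one_mul] at hF
  have h := (hasSum_integral_coeff hs (w := fun u => u) (F := logTerm γ θ a b c)
    (Measurable.aestronglyMeasurable (by fun_prop))
    (ae_restrict_Ioo_mem.mono fun u hu => ⟨hu.1.le, hu.2⟩)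
    hF (integrableOn_rpow_mul_logTerm γ θ a b hc hs)).mul_left (coeff j₁ b)
  have e : ∫ u in Ioo (0 : ℝ) 1, (1 - u) ^ (c * (a + j₁) - 1) * logTerm γ θ a b c u =
      ∫ u in Ioo (0 : ℝ) 1,
        ((1 - u) ^ c) ^ j₁ * ((1 - u) ^ (a * c - 1) * logTerm γ θ a b c u) := by
    refine setIntegral_congr_fun measurableSet_Ioo fun u hu => ?_
    have hu' : 0 < 1 - u := by linarith [hu.2]
    rw [← Real.rpow_natCast, ← Real.rpow_mul hu'.le, ← mul_assoc, ← Real.rpow_add hu']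
    ring_nf
  rw [e] at h
  refine (funext fun j => ?_ : doubleTerm γ θ a b c j₁ = _) ▸ h
  rw [integral_pow_mul_logTerm θ a b hγ hc, doubleTerm, mul_assoc]

/-- Only the factor with exponent `b - 1` is expanded here, in `w = (1 - u) ^ c`; each resulting
integral is already the sum of a series over `j₂`. -/
theorem hasSum_tsum_doubleTerm {γ a b c : ℝ} (θ : ℝ) (hγ : 0 < γ) (ha : 0 < a) (hb : 0 < b)
    (hc : 0 < c) :
    HasSum (fun j₁ : ℕ => ∑' j₂ : ℕ, doubleTerm γ θ a b c j₁ j₂)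
      (∫ u in Ioo (0 : ℝ) 1, unitWeight a b c u * logTerm γ θ a b c u) := by
  simp only [(hasSum_doubleTerm θ b hγ ha hc _).tsum_eq]
  obtain ⟨K, hK⟩ := exists_abs_logTerm_le γ θ a b hc
  have hF := integrableOn_unitWeight_mul ha hb hc (measurable_logTerm γ θ a b c) hK
  simp only [unitWeight, mul_assoc] at hF ⊢
  refine hasSum_integral_coeff hb (w := fun u => (1 - u) ^ c)
    (F := fun u => (1 - u) ^ (a * c - 1) * logTerm γ θ a b c u)
    (Measurable.aestronglyMeasurable (by fun_prop)) ?_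
    (integrableOn_rpow_mul_logTerm γ θ a b hc (mul_pos ha hc)) hF
  filter_upwards [ae_restrict_Ioo_mem] with u hu
  have := one_sub_rpow_mem_Ioo hc hu
  constructor <;> linarith [this.1, this.2]

/-! ### Change of variables -/

lemma iweiCDF_of_pos {γ θ x : ℝ} (hx : 0 < x) : iweiCDF γ θ x = Real.exp (-γ * x ^ (-θ)) :=
  if_pos hx

lemma iweiPDF_of_pos {γ θ x : ℝ} (hx : 0 < x) :
    iweiPDF γ θ x = θ * γ * x ^ (-θ - 1) * Real.exp (-γ * x ^ (-θ)) :=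
  if_pos hx

lemma measurable_iweiCDF (γ θ : ℝ) : Measurable (iweiCDF γ θ) :=
  Measurable.ite measurableSet_Ioi (by fun_prop) measurable_const

lemma measurable_iweiPDF (γ θ : ℝ) : Measurable (iweiPDF γ θ) :=
  Measurable.ite measurableSet_Ioi (by fun_prop) measurable_const

lemma measurable_density (γ θ a b c : ℝ) : Measurable (density γ θ a b c) := by
  have h1 := measurable_iweiCDF γ θ
  have h2 := measurable_iweiPDF γ θ
  unfold density
  fun_prop

lemma iweiPDF_pos {γ θ x : ℝ} (hγ : 0 < γ) (hθ : 0 < θ) (hx : 0 < x) : 0 < iweiPDF γ θ x := by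
  have := Real.rpow_pos_of_pos hx (-θ - 1)
  rw [iweiPDF_of_pos hx]
  positivity

lemma iweiCDF_mem_Ioo {γ θ x : ℝ} (hγ : 0 < γ) (hx : 0 < x) : iweiCDF γ θ x ∈ Ioo (0 : ℝ) 1 := by
  rw [iweiCDF_of_pos hx]
  refine ⟨Real.exp_pos _, Real.exp_lt_one_iff.2 ?_⟩
  have := mul_pos hγ (Real.rpow_pos_of_pos hx (-θ))
  linarith

lemma hasDerivAt_iweiCDF {γ θ x : ℝ} (hx : 0 < x) :
    HasDerivAt (iweiCDF γ θ) (iweiPDF γ θ x) x := by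
  have h := ((Real.hasDerivAt_rpow_const (p := -θ) (Or.inl hx.ne')).const_mul (-γ)).exp
  refine (h.congr_of_eventuallyEq ?_).congr_deriv ?_
  · filter_upwards [lt_mem_nhds hx] with y hy
    exact iweiCDF_of_pos hy
  · rw [iweiPDF_of_pos hx]; ring

lemma injOn_iweiCDF {γ θ : ℝ} (hγ : 0 < γ) (hθ : 0 < θ) : InjOn (iweiCDF γ θ) (Ioi 0) := by
  intro x hx y hy h
  rw [iweiCDF_of_pos hx, iweiCDF_of_pos hy] at h
  have h1 := mul_left_cancel₀ (neg_ne_zero.2 hγ.ne') (Real.exp_injective h)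
  exact (Real.rpow_left_inj (le_of_lt hx) (le_of_lt hy) (neg_ne_zero.2 hθ.ne')).1 h1

lemma image_iweiCDF {γ θ : ℝ} (hγ : 0 < γ) (hθ : 0 < θ) : iweiCDF γ θ '' Ioi 0 = Ioo 0 1 := by
  ext u
  constructor
  · rintro ⟨x, hx, rfl⟩
    exact iweiCDF_mem_Ioo hγ hx
  · intro hu
    have hl : 0 < -Real.log u / γ := div_pos (neg_pos.2 (Real.log_neg hu.1 hu.2)) hγ
    have hx := Real.rpow_pos_of_pos hl (-θ)⁻¹
    refine ⟨(-Real.log u / γ) ^ (-θ)⁻¹, hx, ?_⟩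
    rw [iweiCDF_of_pos hx, Real.rpow_inv_rpow hl.le (neg_ne_zero.2 hθ.ne'),
      show -γ * (-Real.log u / γ) = Real.log u by field_simp, Real.exp_log hu.1]

lemma density_eq {γ θ a b c x : ℝ} :
    density γ θ a b c x = c / beta a b * unitWeight a b c (iweiCDF γ θ x) * iweiPDF γ θ x := by
  unfold density unitWeight; ring

lemma density_of_nonpos {γ θ a b c x : ℝ} (hx : x ≤ 0) : density γ θ a b c x = 0 := by
  simp [density, iweiPDF, hx.not_gt]

lemma unitWeight_pos {a b c u : ℝ} (hc : 0 < c) (hu : u ∈ Ioo (0 : ℝ) 1) :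
    0 < unitWeight a b c u :=
  mul_pos (Real.rpow_pos_of_pos (one_sub_rpow_mem_Ioo hc hu).1 _)
    (Real.rpow_pos_of_pos (by linarith [hu.2]) _)

section

variable {γ θ a b c : ℝ}

lemma density_nonneg (hγ : 0 < γ) (hθ : 0 < θ) (ha : 0 < a) (hb : 0 < b) (hc : 0 < c) (x : ℝ) :
    0 ≤ density γ θ a b c x := by
  rcases lt_or_ge 0 x with hx | hx
  · rw [density_eq]
    exact (mul_pos (mul_pos (div_pos hc (beta_pos ha hb))
      (unitWeight_pos hc (iweiCDF_mem_Ioo hγ hx))) (iweiPDF_pos hγ hθ hx)).le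
  · rw [density_of_nonpos hx]

lemma log_density (hγ : 0 < γ) (hθ : 0 < θ) (ha : 0 < a) (hb : 0 < b) (hc : 0 < c) {x : ℝ}
    (hx : 0 < x) :
    Real.log (density γ θ a b c x) =
      Real.log (c * θ * γ / beta a b) - logTerm γ θ a b c (iweiCDF γ θ x) := by
  have hu := iweiCDF_mem_Ioo (θ := θ) hγ hx
  have hu' : 0 < 1 - iweiCDF γ θ x := by linarith [hu.2]
  have hB := beta_pos ha hb
  have hy := (one_sub_rpow_mem_Ioo hc hu).1
  have hg : iweiPDF γ θ x = θ * γ * x ^ (-θ - 1) * iweiCDF γ θ x := by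
    rw [iweiPDF_of_pos hx, iweiCDF_of_pos hx]
  have hlog : Real.log (-Real.log (iweiCDF γ θ x)) = Real.log γ - θ * Real.log x := by
    rw [iweiCDF_of_pos hx, Real.log_exp, neg_mul, neg_neg,
      Real.log_mul hγ.ne' (Real.rpow_pos_of_pos hx _).ne', Real.log_rpow hx]
    ring
  have e : density γ θ a b c x = c * θ * γ / beta a b * (1 - iweiCDF γ θ x) ^ (a * c - 1)
      * (1 - (1 - iweiCDF γ θ x) ^ c) ^ (b - 1) * x ^ (-θ - 1) * iweiCDF γ θ x := by
    rw [density, hg]; ring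
  have p1 := Real.rpow_pos_of_pos hu' (a * c - 1)
  have p2 := Real.rpow_pos_of_pos hy (b - 1)
  have p3 := Real.rpow_pos_of_pos hx (-θ - 1)
  have p0 : 0 < c * θ * γ / beta a b := by positivity
  rw [e, Real.log_mul (by positivity) hu.1.ne', Real.log_mul (by positivity) p3.ne',
    Real.log_mul (by positivity) p2.ne', Real.log_mul p0.ne' p1.ne', Real.log_rpow hu',
    Real.log_rpow hy, Real.log_rpow hx, logTerm, hlog]
  field_simp
  ring

/-- This exhibits `g = G'` as the Jacobian, the shape required by the change of variables `u =
G(x)`. -/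
lemma density_smul_comp_eq_indicator (hγ : 0 < γ) (hθ : 0 < θ) (ha : 0 < a) (hb : 0 < b)
    (hc : 0 < c) (F : ℝ → ℝ) :
    (fun x => (ENNReal.ofReal (density γ θ a b c x)).toReal • F (iweiCDF γ θ x)) =
      (Ioi 0).indicator fun x => |iweiPDF γ θ x| •
        (c / beta a b * (unitWeight a b c (iweiCDF γ θ x) * F (iweiCDF γ θ x))) := by
  ext x
  rw [ENNReal.toReal_ofReal (density_nonneg hγ hθ ha hb hc x)]
  by_cases hx : 0 < x
  · rw [indicator_of_mem (mem_Ioi.2 hx), abs_of_pos (iweiPDF_pos hγ hθ hx), density_eq]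
    simp only [smul_eq_mul]
    ring
  · rw [indicator_of_notMem (by simpa using hx), density_of_nonpos (not_lt.1 hx), zero_smul]

/-- The law of `G(X)` has density `c / B(a, b) * unitWeight`. -/
lemma integrable_comp_iweiCDF_law (hγ : 0 < γ) (hθ : 0 < θ) (ha : 0 < a) (hb : 0 < b) (hc : 0 < c)
    {F : ℝ → ℝ} (hF : IntegrableOn (fun u => unitWeight a b c u * F u) (Ioo 0 1)) :
    Integrable (fun x => F (iweiCDF γ θ x)) (law γ θ a b c) := by
  have h := (hF.const_mul (c / beta a b))
  rw [← IntegrableOn, ← image_iweiCDF hγ hθ, integrableOn_image_iff_integrableOn_abs_deriv_smul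
    measurableSet_Ioi (fun x hx => (hasDerivAt_iweiCDF hx).hasDerivWithinAt)
    (injOn_iweiCDF hγ hθ)] at h
  rw [law, integrable_withDensity_iff_integrable_smul'
    (measurable_density γ θ a b c).ennreal_ofReal (by simp),
    density_smul_comp_eq_indicator hγ hθ ha hb hc]
  exact (integrable_indicator_iff measurableSet_Ioi).2 h

lemma integral_comp_iweiCDF_law (hγ : 0 < γ) (hθ : 0 < θ) (ha : 0 < a) (hb : 0 < b) (hc : 0 < c)
    (F : ℝ → ℝ) :
    ∫ x, F (iweiCDF γ θ x) ∂law γ θ a b c =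
      c / beta a b * ∫ u in Ioo (0 : ℝ) 1, unitWeight a b c u * F u := by
  rw [law, integral_withDensity_eq_integral_toReal_smul
    (measurable_density γ θ a b c).ennreal_ofReal (by simp),
    density_smul_comp_eq_indicator hγ hθ ha hb hc, integral_indicator measurableSet_Ioi,
    ← integral_const_mul, ← image_iweiCDF hγ hθ, integral_image_eq_integral_abs_deriv_smul
    measurableSet_Ioi (fun x hx => (hasDerivAt_iweiCDF hx).hasDerivWithinAt)
    (injOn_iweiCDF hγ hθ)]

lemma ae_law_pos (γ θ a b c : ℝ) : ∀ᵐ x ∂law γ θ a b c, 0 < x := by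
  rw [law, ae_withDensity_iff (measurable_density γ θ a b c).ennreal_ofReal]
  refine Eventually.of_forall fun x hx => ?_
  by_contra h
  exact hx (by rw [density_of_nonpos (not_lt.1 h), ENNReal.ofReal_zero])

/-- Almost surely, `log f_X` is an explicit function of `G`. -/
lemma log_pdf_ae_eq {Ω : Type*} [MeasurableSpace Ω] {P : Measure Ω} {X : Ω → ℝ}
    (hγ : 0 < γ) (hθ : 0 < θ) (ha : 0 < a) (hb : 0 < b) (hc : 0 < c)
    (hX : HasLaw X (law γ θ a b c) P) :
    (fun x => Real.log (pdf X P volume x).toReal) =ᵐ[law γ θ a b c] fun x =>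
      Real.log (c * θ * γ / beta a b) - logTerm γ θ a b c (iweiCDF γ θ x) := by
  have h : pdf X P volume =ᵐ[law γ θ a b c] fun x => ENNReal.ofReal (density γ θ a b c x) := by
    -- A Radon–Nikodym derivative is determined only Lebesgue-almost everywhere; absolute continuity
    -- transfers the equality to the law.
    refine (withDensity_absolutelyContinuous volume _).ae_le ?_
    rw [pdf_def, hX.map_eq]
    exact Measure.rnDeriv_withDensity _ (measurable_density γ θ a b c).ennreal_ofReal
  filter_upwards [h, ae_law_pos γ θ a b c] with x hx hx0
  rw [hx, ENNReal.toReal_ofReal (density_nonneg hγ hθ ha hb hc x), log_density hγ hθ ha hb hc hx0]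

end

end RGB1IWei

/-! ### The entropy formula -/

theorem mainTheorem5 {Ω : Type*} [MeasurableSpace Ω] (P : Measure Ω) [IsProbabilityMeasure P]
    (X : Ω → ℝ) (γ θ a b c : ℝ) (hγ : 0 < γ) (hθ : 0 < θ) (ha : 0 < a) (hb : 0 < b) (hc : 0 < c)
    (hX : HasLaw X (RGB1IWei.law γ θ a b c) P) :
    Integrable (fun ω => Real.log (pdf X P volume (X ω)).toReal) P ∧
    (∀ j₂ : ℕ, Summable fun i : ℕ => RGB1IWei.innerTerm c j₂ i) ∧
    (∀ j₁ : ℕ, Summable fun j₂ : ℕ => RGB1IWei.doubleTerm γ θ a b c j₁ j₂) ∧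
    (Summable fun j₁ : ℕ => ∑' j₂ : ℕ, RGB1IWei.doubleTerm γ θ a b c j₁ j₂) ∧
    RGB1IWei.shannonEntropy X P =
      -Real.log (c * θ * γ / beta a b) +
        c / beta a b * ∑' j₁ : ℕ, ∑' j₂ : ℕ, RGB1IWei.doubleTerm γ θ a b c j₁ j₂ := by
  open RGB1IWei in
  -- Total mass one is inherited from `P` through `X`, so the normalization of the density need not
  -- be computed.
  have hprob : IsProbabilityMeasure (law γ θ a b c) :=
    hX.map_eq ▸ Measure.isProbabilityMeasure_map hX.aemeasurable
  have hsum := hasSum_tsum_doubleTerm θ hγ ha hb hc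
  have hae := log_pdf_ae_eq hγ hθ ha hb hc hX
  have hmeas : AEStronglyMeasurable (fun x => Real.log (pdf X P volume x).toReal) (P.map X) :=
    (Real.measurable_log.comp (measurable_pdf X P volume).ennreal_toReal).aestronglyMeasurable
  obtain ⟨K, hK⟩ := exists_abs_logTerm_le γ θ a b hc
  have hint := integrable_comp_iweiCDF_law hγ hθ ha hb hc
    (integrableOn_unitWeight_mul ha hb hc (measurable_logTerm γ θ a b c) hK)
  have hlog := (integrable_const (Real.log (c * θ * γ / beta a b))).sub hint
  refine ⟨?_, fun j₂ => (hasSum_innerTerm hc j₂).summable,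
    fun j₁ => (hasSum_doubleTerm θ b hγ ha hc j₁).summable, hsum.summable, ?_⟩
  · refine Integrable.comp_aemeasurable (f := X)
      (g := fun x => Real.log (pdf X P volume x).toReal) ?_ hX.aemeasurable
    rw [hX.map_eq]
    exact hlog.congr hae.symm
  · rw [shannonEntropy, ← integral_map hX.aemeasurable hmeas, hX.map_eq, integral_congr_ae hae,
      integral_sub (integrable_const _) hint, integral_comp_iweiCDF_law hγ hθ ha hb hc,
      hsum.tsum_eq]
    simp
    ring
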